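/- Lemma 3.6 (Posterior concentration). Let $\theta_0$ be a probability mass function on $\{1,2,\dots\}$, let $(k_n)$ be a non-decreasing sequence of positive integers and $(M_n)$ a sequence of reals increasing to $+\infty$. Write $\theta_0$ also for its truncation at level $k_n$, the p.m.f. on $\{0,\dots,k_n\}$ with $\theta_0(0)=\sum_{i>k_n}\theta_0(i)$. Let $\Theta_{k}$ be the set of p.m.f.s on $\{0,\dots,k\}$. Let $\mathbb P_{n,0}$ be the law on $\{0,\dots,k_n\}^n$ of an i.i.d. sample of size $n$ from the truncated $\theta_0$. Let $W_n$ be a prior probability distribution on $\Theta_{k_n}$ under which $(\theta(1),\dots,\theta(k_n))$ has density $w_n\ge 0$ with respect to Lebesgue measure on $\mathbb R^{k_n}$. Let $\tau\sim W_n$ and, given $\tau$, let $X_{1:n}=(X_1,\dots,X_n)$ be i.i.d. with p.m.f. $\tau$. Put $H_n=\sqrt n\,(\tau(i)-\theta_0(i))_{1\le i\le k_n}$, identified with the vector of $\mathbb R^{k_n+1}$ with index set $0\le i\le k_n$ defined by the same formula, and let $P_{H_n|X_{1:n}}$ be the posterior distribution of $H_n$, i.e. its conditional distribution given $X_{1:n}$.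 Let $$I(\theta_0)=\mathrm{Diag}\Big(\frac1{\theta_0(i)}\Big)_{1\le i\le k_n}+\frac1{\theta_0(0)}\mathbf 1\mathbf 1^T,\qquad \sigma_n^2(h)=\sum_{i=0}^{k_n}\frac{h(i)^2}{\theta_0(i)}\quad(0/0=0),$$ $$\mathcal E_{\theta_0,k_n}(M)=\Big\{h\in\mathbb R^{k_n+1}:\ \sigma_n^2(h)\le M,\ \sum_{i=0}^{k_n}h(i)=0,\ h(i)\ge-\sqrt n\,\theta_0(i)\ (0\le i\le k_n)\Big\}.$$ Here $w_n(\theta_0+h/\sqrt n)$ is $w_n$ evaluated at the coordinates $1,\dots,k_n$. Assume that, as $n\to\infty$, - (Condition 2.1) $n\inf_{0\le i\le k_n}\theta_0(i)\to+\infty$; - (Condition 3.4, prior smoothness) $\displaystyle\sup_{h,g\in\mathcal E_{\theta_0,k_n}(M_n)}\frac{w_n(\theta_0+h/\sqrt n)}{w_n(\theta_0+g/\sqrt n)}\to1$, the ratio being $+\infty$ where only its denominator vanishes; - (Condition 3.5, prior concentration) $\displaystyle\frac{k_n}2\log n\ \vee\ \log\det I(\theta_0)\ \vee\ -\log w_n(\theta_0)=o(M_n)$,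 where $-\log 0=+\infty$ (so $w_n(\theta_0)>0$ for all large $n$); - $M_n=o\big(n\inf_{0\le i\le k_n}\theta_0(i)\big)$. Then, for all sufficiently large $n$, $$\mathbb P_{n,0}\,P_{H_n|X_{1:n}}\big(H_n^TI(\theta_0)H_n\ge M_n\big)=\mathbb P_{n,0}\,P_{H_n|X_{1:n}}\big(H_n\notin\mathcal E_{\theta_0,k_n}(M_n)\big),$$ where $\mathbb P_{n,0}$ applied to a random variable denotes its expectation, and this quantity tends to $0$ as $n\to\infty$. -/

import Mathlib

open MeasureTheory ProbabilityTheory Filter Asymptotics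
open scoped Topology ENNReal NNReal Matrix

namespace PosteriorConcentration

/-- Truncation at level `k` of an observation `x ∈ {1, 2, …}`: it is kept if `x ≤ k` and replaced
by `0` otherwise. -/
def trunc (k : ℕ) (x : ℕ+) : Fin (k + 1) :=
  if h : (x : ℕ) ≤ k then ⟨x, Nat.lt_succ_of_le h⟩ else 0

/-- The image of a p.m.f. on `{1, 2, …}` by truncation at level `k`, as a point of `Θ_k`, the set
of p.m.f.s on `{0, …, k}`. -/
noncomputable def truncPmf (θ₀ : PMF ℕ+) (k : ℕ) : stdSimplex ℝ (Fin (k + 1)) :=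
  ⟨fun i => ((θ₀.map (trunc k)) i).toReal, fun _ => ENNReal.toReal_nonneg, by
    rw [← ENNReal.toReal_sum fun i _ => PMF.apply_ne_top _ i, ← tsum_fintype (L := .unconditional _),
      PMF.tsum_coe, ENNReal.toReal_one]⟩

/-- The probability measure on `{0, …, k}` with p.m.f. `θ`. -/
noncomputable def pmfMeasure {k : ℕ} (θ : stdSimplex ℝ (Fin (k + 1))) : Measure (Fin (k + 1)) :=
  ∑ i, ENNReal.ofReal (θ i) • Measure.dirac i

instance {k : ℕ} (θ : stdSimplex ℝ (Fin (k + 1))) : IsProbabilityMeasure (pmfMeasure θ) := by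
  constructor
  simp only [pmfMeasure, Measure.coe_finsetSum, Finset.sum_apply, Measure.smul_apply,
    measure_univ, smul_eq_mul, mul_one]
  have h := ENNReal.ofReal_sum_of_nonneg (s := Finset.univ) (f := fun i => θ i)
    fun i _ => θ.2.1 i
  exact h.symm.trans ((congrArg ENNReal.ofReal θ.2.2).trans ENNReal.ofReal_one)

/-- The law on `{0, …, k}ⁿ` of an i.i.d. sample of size `n` from `θ`. -/
noncomputable def sampleLaw (n : ℕ) {k : ℕ} (θ : stdSimplex ℝ (Fin (k + 1))) :
    Measure (Fin n → Fin (k + 1)) :=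
  Measure.pi fun _ => pmfMeasure θ

instance (n : ℕ) {k : ℕ} (θ : stdSimplex ℝ (Fin (k + 1))) :
    IsProbabilityMeasure (sampleLaw n θ) := by
  unfold sampleLaw; infer_instance

theorem pmfMeasure_singleton {k : ℕ} (θ : stdSimplex ℝ (Fin (k + 1))) (j : Fin (k + 1)) :
    pmfMeasure θ {j} = ENNReal.ofReal (θ j) := by
  simp [pmfMeasure, Set.indicator_apply]

theorem sampleLaw_singleton (n : ℕ) {k : ℕ} (θ : stdSimplex ℝ (Fin (k + 1)))
    (x : Fin n → Fin (k + 1)) : sampleLaw n θ {x} = ∏ j, ENNReal.ofReal (θ (x j)) := by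
  simp [sampleLaw, pmfMeasure_singleton]

theorem measurable_sampleLaw (n k : ℕ) :
    Measurable fun θ : stdSimplex ℝ (Fin (k + 1)) => sampleLaw n θ := by
  refine Measure.measurable_of_measurable_coe _ fun s _ => ?_
  have h : (fun θ : stdSimplex ℝ (Fin (k + 1)) => sampleLaw n θ s) =
      fun θ => ∑ x ∈ s.toFinite.toFinset, ∏ j, ENNReal.ofReal (θ (x j)) := by
    funext θ
    simp_rw [← sampleLaw_singleton]
    rw [sum_measure_singleton, Set.Finite.coe_toFinset]
  rw [h]
  refine Finset.measurable_sum _ fun x _ => Finset.measurable_prod _ fun j _ => ?_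
  exact ((measurable_pi_apply (x j)).comp measurable_subtype_coe).ennreal_ofReal

/-- The statistical model: conditionally on the parameter `θ ∈ Θ_k`, the sample
`X_{1:n} ∈ {0, …, k}ⁿ` is i.i.d. with p.m.f. `θ`. -/
noncomputable def model (n k : ℕ) :
    Kernel (stdSimplex ℝ (Fin (k + 1))) (Fin n → Fin (k + 1)) where
  toFun θ := sampleLaw n θ
  measurable' := measurable_sampleLaw n k

instance (n k : ℕ) : IsMarkovKernel (model n k) :=
  ⟨fun θ => inferInstanceAs (IsProbabilityMeasure (sampleLaw n θ))⟩

/-- The smallest cell probability `inf_{0 ≤ i ≤ k} θ(i)`. -/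
noncomputable def minProb {k : ℕ} (θ : stdSimplex ℝ (Fin (k + 1))) : ℝ := ⨅ i, θ i

/-- The `k × k` Fisher information matrix
`I(θ) = Diag(1/θ(1), …, 1/θ(k)) + (1/θ(0)) 𝟏𝟏ᵀ`. -/
noncomputable def fisherInfo {k : ℕ} (θ : stdSimplex ℝ (Fin (k + 1))) :
    Matrix (Fin k) (Fin k) ℝ :=
  Matrix.diagonal (fun i => 1 / θ i.succ) + Matrix.of fun _ _ => 1 / θ 0

/-- `σ_n²(h) = ∑_{i=0}^k h(i)² / θ₀(i)`. -/
noncomputable def sigmaSq {k : ℕ} (θ : stdSimplex ℝ (Fin (k + 1))) (h : Fin (k + 1) → ℝ) : ℝ :=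
  ∑ i, h i ^ 2 / θ i

/-- The set `ℰ_{θ₀,k}(M)` of the `h ∈ ℝ^{k+1}` with `σ_n²(h) ≤ M`, `∑ h(i) = 0` and
`h(i) ≥ -√n θ₀(i)`. As `h(i)²/θ₀(i)` is infinite where `θ₀(i) = 0 ≠ h(i)`, such `h` are
excluded. -/
noncomputable def ellipsoid (n : ℕ) {k : ℕ} (θ : stdSimplex ℝ (Fin (k + 1))) (M : ℝ) :
    Set (Fin (k + 1) → ℝ) :=
  {h | (∀ i, θ i = 0 → h i = 0) ∧ sigmaSq θ h ≤ M ∧ ∑ i, h i = 0 ∧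
    ∀ i, -(√(n : ℝ) * θ i) ≤ h i}

/-- The rescaled deviation `√n (τ(i) - θ₀(i))`, `0 ≤ i ≤ k`; its last `k` coordinates form the
vector `H_n`. -/
noncomputable def deviation (n : ℕ) {k : ℕ} (θ τ : stdSimplex ℝ (Fin (k + 1))) :
    Fin (k + 1) → ℝ :=
  fun i => √(n : ℝ) * (τ i - θ i)

/-- The quadratic form `hᵀ I(θ₀) h` on `ℝ^k`. -/
noncomputable def fisherForm {k : ℕ} (θ : stdSimplex ℝ (Fin (k + 1))) (h : Fin k → ℝ) : ℝ :=
  h ⬝ᵥ (fisherInfo θ *ᵥ h)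

/-- `w(θ₀ + h/√n)`, for a density `w` on `ℝ^k`, which is a function of the coordinates
`1, …, k`. -/
noncomputable def densityAt (n : ℕ) {k : ℕ} (θ : stdSimplex ℝ (Fin (k + 1)))
    (w : (Fin k → ℝ) → ℝ≥0) (h : Fin (k + 1) → ℝ) : ℝ≥0 :=
  w (Fin.tail fun i => θ i + h i / √(n : ℝ))

/-- Condition on the truncation levels: `n inf_{i ≤ k_n} θ₀(i) → +∞`. -/
def TruncationCondition (θ₀ : PMF ℕ+) (k : ℕ → ℕ) : Prop :=
  Tendsto (fun n : ℕ => (n : ℝ) * minProb (truncPmf θ₀ (k n))) atTop atTop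

/-- Prior smoothness: the supremum over `h, g ∈ ℰ_{θ₀,k_n}(M_n)` of
`w_n(θ₀ + h/√n) / w_n(θ₀ + g/√n)` tends to `1`. The ratio is taken in `[0, ∞]`, so that it is
infinite where only the denominator vanishes. -/
def PriorSmoothness (θ₀ : PMF ℕ+) (k : ℕ → ℕ) (w : ∀ n, (Fin (k n) → ℝ) → ℝ≥0) (M : ℕ → ℝ) :
    Prop :=
  Tendsto (fun n : ℕ =>
    ⨆ h ∈ ellipsoid n (truncPmf θ₀ (k n)) (M n), ⨆ g ∈ ellipsoid n (truncPmf θ₀ (k n)) (M n),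
      (densityAt n (truncPmf θ₀ (k n)) (w n) h : ℝ≥0∞) /
        (densityAt n (truncPmf θ₀ (k n)) (w n) g : ℝ≥0∞)) atTop (𝓝 1)

/-- Prior concentration:
`(k_n/2) log n ∨ log det I(θ₀) ∨ (-log w_n(θ₀)) = o(M_n)`, where `-log 0 = +∞`, so that
`w_n(θ₀) > 0` for all large `n`. -/
def PriorConcentration (θ₀ : PMF ℕ+) (k : ℕ → ℕ) (w : ∀ n, (Fin (k n) → ℝ) → ℝ≥0)
    (M : ℕ → ℝ) : Prop :=
  (∀ᶠ n in atTop, 0 < w n (Fin.tail (truncPmf θ₀ (k n)))) ∧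
  (fun n : ℕ => max (max ((k n : ℝ) / 2 * Real.log n)
      (Real.log (fisherInfo (truncPmf θ₀ (k n))).det))
      (-Real.log (w n (Fin.tail (truncPmf θ₀ (k n)))))) =o[atTop] M

/-- `W` is a prior probability distribution for `θ ∈ Θ_k` such that `(θ(1), …, θ(k))` has
density `w` with respect to Lebesgue measure on `ℝ^k`. -/
def IsPriorWithDensity {k : ℕ} (W : Measure (stdSimplex ℝ (Fin (k + 1))))
    (w : (Fin k → ℝ) → ℝ≥0) : Prop :=
  Measurable w ∧ W.map (fun θ : stdSimplex ℝ (Fin (k + 1)) => Fin.tail θ) =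
    (volume : Measure (Fin k → ℝ)).withDensity fun u => (w u : ℝ≥0∞)

/-- The expectation under `ℙ_{n,0}`, the law of an i.i.d. sample from the truncated `θ₀`, of the
posterior probability, given the sample and for the prior `W`, of a set `A` of parameters. -/
noncomputable def expectedPosterior (θ₀ : PMF ℕ+) (n k : ℕ)
    (W : Measure (stdSimplex ℝ (Fin (k + 1)))) [IsProbabilityMeasure W]
    (A : Set (stdSimplex ℝ (Fin (k + 1)))) : ℝ≥0∞ :=
  ∫⁻ x, posterior (model n k) W x A ∂(sampleLaw n (truncPmf θ₀ k))

end PosteriorConcentration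

open PosteriorConcentration

/-! Since the coordinates of a deviation sum to zero, the Fisher form of `H_n` is `n` times the
chi-square divergence `chiSq τ θ₀`, so everything reduces to posterior mass outside a chi-square
ball. The likelihoods at `τ` and at `θ₀` are compared through the empirical p.m.f., the maximiser of
the likelihood. Relative to it, the likelihood at `p` loses at least the exponent `n * hellSq` and
at most `n * chiSq`.

Pearson's statistic has mean at most `k + 1`, which is `o(M)`, so by Markov the empirical p.m.f. is
typically within `M / 1000` of `θ₀`. For such samples the likelihood ratio to `θ₀` is at most `exp
(-(1/18 - 2/1000) M)` where `n χ² ≥ M` (`prod_le_exp_neg_mul_prod`) and at least `exp (-8M/1000)`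
where `n χ² ≤ M / 1000` (`exp_neg_mul_prod_le_prod`). The prior gives the latter ball mass at least
`exp (-7M/1000) / 2`, by a small cube and the two prior conditions (`le_prior_chiSq_le`,
`le_half_mul_pow`). Bayes' formula then bounds the posterior mass by `2 exp (-M/50)`.

The two events differ only by the boundary of an ellipsoid, which is null for a prior with a density
(`prior_chiSq_eq`). -/

namespace PosteriorConcentration

/-! ### Comparison of the chi-square and Hellinger divergences -/

section Divergences

variable {ι : Type*} [Fintype ι]

/-- The chi-square divergence `∑ (p(i) - q(i))² / q(i)`. -/
noncomputable def chiSq (p q : ι → ℝ) : ℝ := ∑ i, (p i - q i) ^ 2 / q i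

/-- The squared Hellinger distance `∑ (√p(i) - √q(i))²`. -/
noncomputable def hellSq (p q : ι → ℝ) : ℝ := ∑ i, (√(p i) - √(q i)) ^ 2

theorem hellSq_nonneg (p q : ι → ℝ) : 0 ≤ hellSq p q :=
  Finset.sum_nonneg fun _ _ => sq_nonneg _

theorem hellSq_le_two_mul_add (p q r : ι → ℝ) :
    hellSq p r ≤ 2 * hellSq p q + 2 * hellSq q r := by
  simp only [hellSq, Finset.mul_sum, ← Finset.sum_add_distrib]
  refine Finset.sum_le_sum fun i _ => ?_
  nlinarith [sq_nonneg (√(p i) - √(q i) - (√(q i) - √(r i)))]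

theorem sq_sub_eq_sqrt {a b : ℝ} (ha : 0 ≤ a) (hb : 0 ≤ b) :
    (a - b) ^ 2 = (√a - √b) ^ 2 * (√a + √b) ^ 2 := by
  rw [← mul_pow]
  congr 1
  nlinarith [Real.sq_sqrt ha, Real.sq_sqrt hb]

theorem hellSq_le_chiSq {p q : ι → ℝ} (hp : ∀ i, 0 ≤ p i) (hq : ∀ i, 0 < q i) :
    hellSq p q ≤ chiSq p q := by
  refine Finset.sum_le_sum fun i _ => ?_
  rw [le_div_iff₀ (hq i), sq_sub_eq_sqrt (hp i) (hq i).le]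
  refine mul_le_mul_of_nonneg_left ?_ (sq_nonneg _)
  nlinarith [Real.sq_sqrt (hq i).le, Real.sqrt_nonneg (p i), Real.sqrt_nonneg (q i)]

/-- If `p ≤ 4q` everywhere, then `(√p + √q)² ≤ 9q` and the two divergences are comparable up to the
factor 9. Otherwise a single cell with `p > 4q` already contributes at least `q ≥ r` to the
Hellinger distance. -/
theorem le_hellSq_of_le_chiSq {p q : ι → ℝ} {r : ℝ} (hp : ∀ i, 0 ≤ p i) (hq : ∀ i, 0 < q i)
    (hr : ∀ i, r ≤ q i) (h : 9 * r ≤ chiSq p q) : r ≤ hellSq p q := by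
  by_cases hb : ∀ i, p i ≤ 4 * q i
  · have : chiSq p q ≤ 9 * hellSq p q := by
      simp only [chiSq, hellSq, Finset.mul_sum]
      refine Finset.sum_le_sum fun i _ => ?_
      rw [div_le_iff₀ (hq i), sq_sub_eq_sqrt (hp i) (hq i).le]
      have h2 : √(p i) ≤ 2 * √(q i) := by
        rw [Real.sqrt_le_left (by positivity), mul_pow, Real.sq_sqrt (hq i).le]
        linarith [hb i]
      have h3 : (√(p i) + √(q i)) ^ 2 ≤ 9 * q i := by
        nlinarith [Real.sq_sqrt (hq i).le, Real.sqrt_nonneg (p i), Real.sqrt_nonneg (q i)]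
      nlinarith [mul_le_mul_of_nonneg_left h3 (sq_nonneg (√(p i) - √(q i)))]
    linarith
  · push Not at hb
    obtain ⟨i, hi⟩ := hb
    have h2 : 2 * √(q i) ≤ √(p i) := by
      refine Real.le_sqrt_of_sq_le ?_
      rw [mul_pow, Real.sq_sqrt (hq i).le]
      linarith
    refine (hr i).trans ?_
    refine le_trans ?_ (Finset.single_le_sum (f := fun i => (√(p i) - √(q i)) ^ 2)
      (fun _ _ => sq_nonneg _) (Finset.mem_univ i))
    nlinarith [Real.sq_sqrt (hq i).le, Real.sqrt_nonneg (q i)]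

theorem chiSq_le_of_half_le {p q r : ι → ℝ} (hq : ∀ i, 0 < q i) (hr : ∀ i, q i / 2 ≤ r i) :
    chiSq p r ≤ 4 * (chiSq p q + chiSq r q) := by
  simp only [chiSq, ← Finset.sum_add_distrib, Finset.mul_sum]
  refine Finset.sum_le_sum fun i _ => ?_
  have hq' := hq i
  have h1 : (p i - r i) ^ 2 / r i ≤ (p i - r i) ^ 2 / (q i / 2) :=
    div_le_div_of_nonneg_left (sq_nonneg _) (by positivity) (hr i)
  refine h1.trans ?_
  rw [← add_div, div_le_iff₀ (by positivity)]
  field_simp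
  nlinarith [sq_nonneg ((p i - q i) + (r i - q i))]

/-- Each cell satisfies `(p - q)² ≤ r q ≤ q² / 4`. -/
theorem half_le_of_chiSq_le {p q : ι → ℝ} {r : ℝ} (hq : ∀ i, 0 < q i) (hr : ∀ i, 4 * r ≤ q i)
    (h : chiSq p q ≤ r) (i : ι) : q i / 2 ≤ p i := by
  have h1 : (p i - q i) ^ 2 / q i ≤ r :=
    (Finset.single_le_sum (f := fun i => (p i - q i) ^ 2 / q i)
      (fun j _ => div_nonneg (sq_nonneg _) (hq j).le) (Finset.mem_univ i)).trans h
  rw [div_le_iff₀ (hq i)] at h1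
  nlinarith [hr i, hq i]

end Divergences

/-! ### Likelihood ratios through the empirical distribution -/

section Likelihood

variable {ι : Type*} [DecidableEq ι] {n : ℕ}

/-- The empirical p.m.f. of a sample. -/
noncomputable def empirical (x : Fin n → ι) (i : ι) : ℝ :=
  (∑ j, if x j = i then (1 : ℝ) else 0) / n

theorem empirical_nonneg (x : Fin n → ι) (i : ι) : 0 ≤ empirical x i :=
  div_nonneg (Finset.sum_nonneg fun _ _ => by split_ifs <;> simp) (Nat.cast_nonneg _)

theorem empirical_pos (hn : n ≠ 0) (x : Fin n → ι) (j : Fin n) : 0 < empirical x (x j) := by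
  refine div_pos ?_ (by positivity)
  refine lt_of_lt_of_le one_pos ?_
  refine le_trans ?_ (Finset.single_le_sum (f := fun l => if x l = x j then (1 : ℝ) else 0)
    (fun _ _ => by split_ifs <;> simp) (Finset.mem_univ j))
  simp

variable [Fintype ι]

theorem sum_comp_eq_empirical (hn : n ≠ 0) (x : Fin n → ι) (f : ι → ℝ) :
    ∑ j, f (x j) = n * ∑ i, empirical x i * f i := by
  have hn' : (n : ℝ) ≠ 0 := Nat.cast_ne_zero.2 hn
  simp_rw [empirical, div_mul_eq_mul_div, ← Finset.sum_div]
  rw [mul_div_cancel₀ _ hn']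
  simp_rw [Finset.sum_mul]
  rw [Finset.sum_comm]
  simp

theorem sum_empirical (hn : n ≠ 0) (x : Fin n → ι) : ∑ i, empirical x i = 1 := by
  have h := sum_comp_eq_empirical hn x fun _ => 1
  have hn' : (n : ℝ) ≠ 0 := Nat.cast_ne_zero.2 hn
  simp only [Finset.sum_const, Finset.card_univ, Fintype.card_fin, nsmul_eq_mul, mul_one] at h
  field_simp at h
  exact h.symm

/-- With `e` the empirical p.m.f., each factor satisfies `p / e = √(p / e)² ≤ exp (2 (√(p / e) -
1))`. Summed over the sample, the exponents give `2n (∑ √(e p) - 1)`, which is `-n` times the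
squared Hellinger distance. -/
theorem prod_le_exp_mul_prod_empirical (hn : n ≠ 0) (x : Fin n → ι) {p : ι → ℝ}
    (hp : ∀ i, 0 ≤ p i) (hp1 : ∑ i, p i = 1) :
    ∏ j, p (x j) ≤ Real.exp (-(n * hellSq (empirical x) p)) * ∏ j, empirical x (x j) := by
  set e := empirical x
  have he : ∀ i, 0 ≤ e i := empirical_nonneg x
  have key : ∑ j, 2 * (√(p (x j) / e (x j)) - 1) = -(n * hellSq e p) := by
    rw [sum_comp_eq_empirical hn x fun i => 2 * (√(p i / e i) - 1), ← mul_neg]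
    congr 1
    have h1 : ∀ i, e i * (2 * (√(p i / e i) - 1)) = p i - e i - (√(e i) - √(p i)) ^ 2 := by
      intro i
      have hs := Real.sq_sqrt (he i)
      have hs' := Real.sq_sqrt (hp i)
      have : e i * √(p i / e i) = √(e i) * √(p i) := by
        rw [Real.sqrt_div (hp i)]
        -- Unobserved cells have `e i = 0`; both sides then vanish.
        rcases (he i).eq_or_lt with h0 | h0
        · simp [← h0]
        · have := Real.sqrt_pos.2 h0
          field_simp
          rw [hs]
          ring
      nlinarith
    simp_rw [show ∀ i, empirical x i = e i from fun _ => rfl, h1]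
    rw [Finset.sum_sub_distrib, Finset.sum_sub_distrib, hp1, sum_empirical hn, hellSq]
    ring
  rw [← key, Real.exp_sum, ← Finset.prod_mul_distrib]
  refine Finset.prod_le_prod (fun j _ => hp _) fun j _ => ?_
  have hpos : 0 < e (x j) := empirical_pos hn x j
  rw [← div_le_iff₀ hpos, two_mul, Real.exp_add]
  have h2 : √(p (x j) / e (x j)) ≤ Real.exp (√(p (x j) / e (x j)) - 1) := by
    linarith [Real.add_one_le_exp (√(p (x j) / e (x j)) - 1)]
  calc p (x j) / e (x j) = √(p (x j) / e (x j)) * √(p (x j) / e (x j)) :=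
        (Real.mul_self_sqrt (div_nonneg (hp _) hpos.le)).symm
    _ ≤ _ := mul_le_mul h2 h2 (Real.sqrt_nonneg _) (Real.exp_pos _).le

/-- Here `e / q ≤ exp (e / q - 1)` factor by factor, and the mean of `e / q - 1` under `e` is the
chi-square divergence. -/
theorem prod_empirical_le_exp_mul_prod (hn : n ≠ 0) (x : Fin n → ι) {q : ι → ℝ}
    (hq : ∀ i, 0 < q i) (hq1 : ∑ i, q i = 1) :
    ∏ j, empirical x (x j) ≤ Real.exp (n * chiSq (empirical x) q) * ∏ j, q (x j) := by
  set e := empirical x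
  have key : ∑ j, (e (x j) / q (x j) - 1) = n * chiSq e q := by
    rw [sum_comp_eq_empirical hn x fun i => e i / q i - 1]
    congr 1
    have h1 : ∀ i, e i * (e i / q i - 1) = (e i - q i) ^ 2 / q i + (e i - q i) := by
      intro i
      have := (hq i).ne'
      field_simp
      ring
    simp_rw [show ∀ i, empirical x i = e i from fun _ => rfl, h1]
    rw [Finset.sum_add_distrib, Finset.sum_sub_distrib, hq1, sum_empirical hn, chiSq]
    ring
  rw [← key, Real.exp_sum, ← Finset.prod_mul_distrib]
  refine Finset.prod_le_prod (fun j _ => empirical_nonneg x _) fun j _ => ?_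
  rw [← div_le_iff₀ (hq _)]
  linarith [Real.add_one_le_exp (e (x j) / q (x j) - 1)]

/-- Far from `q`, the likelihood is exponentially small compared to the likelihood at `q`, for
samples whose empirical p.m.f. is close to `q`. -/
theorem prod_le_exp_neg_mul_prod (hn : n ≠ 0) (x : Fin n → ι) {p q : ι → ℝ} {M ε : ℝ}
    (hp : ∀ i, 0 ≤ p i) (hp1 : ∑ i, p i = 1) (hq : ∀ i, 0 < q i) (hq1 : ∑ i, q i = 1)
    (hM : ∀ i, M ≤ 9 * (n * q i)) (hx : n * chiSq (empirical x) q ≤ ε * M)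
    (hpq : M ≤ n * chiSq p q) :
    ∏ j, p (x j) ≤ Real.exp (-((1 / 18 - 2 * ε) * M)) * ∏ j, q (x j) := by
  have hn' : (0 : ℝ) < n := by positivity
  -- The parallelogram-type bound halves this `1/9` to `1/18`; passing from `q` to the empirical
  -- p.m.f. then costs `ε M` twice, once in Hellinger distance and once in likelihood.
  have h1 : M / (9 * n) ≤ hellSq p q := by
    refine le_hellSq_of_le_chiSq hp hq (fun i => ?_) ?_
    · rw [div_le_iff₀ (by positivity)]; linarith [hM i]
    · rw [mul_div_assoc', div_le_iff₀ (by positivity)]; linarith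
  rw [div_le_iff₀ (by positivity)] at h1
  have h2 := mul_le_mul_of_nonneg_left (hellSq_le_chiSq (empirical_nonneg x) hq) hn'.le
  have h3 := mul_le_mul_of_nonneg_left (hellSq_le_two_mul_add p (empirical x) q) hn'.le
  have h4 : hellSq p (empirical x) = hellSq (empirical x) p :=
    Finset.sum_congr rfl fun _ _ => by ring
  rw [h4] at h3
  refine (prod_le_exp_mul_prod_empirical hn x hp hp1).trans ?_
  refine (mul_le_mul_of_nonneg_left (prod_empirical_le_exp_mul_prod hn x hq hq1)
    (Real.exp_pos _).le).trans ?_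
  rw [← mul_assoc, ← Real.exp_add]
  refine mul_le_mul_of_nonneg_right (Real.exp_le_exp.2 ?_)
    (Finset.prod_nonneg fun j _ => (hq _).le)
  linarith

/-- Near `q`, the likelihood is not much smaller than the likelihood at `q`, for samples whose
empirical p.m.f. is close to `q`. -/
theorem exp_neg_mul_prod_le_prod (hn : n ≠ 0) (x : Fin n → ι) {p q : ι → ℝ} {M ε : ℝ}
    (hp1 : ∑ i, p i = 1) (hq : ∀ i, 0 < q i) (hq1 : ∑ i, q i = 1)
    (hM : ∀ i, 4 * (ε * M) ≤ n * q i) (hx : n * chiSq (empirical x) q ≤ ε * M)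
    (hpq : n * chiSq p q ≤ ε * M) :
    Real.exp (-(8 * ε * M)) * ∏ j, q (x j) ≤ ∏ j, p (x j) := by
  have hn' : (0 : ℝ) < n := by positivity
  have hhalf : ∀ i, q i / 2 ≤ p i := by
    refine half_le_of_chiSq_le (r := ε * M / n) hq (fun i => ?_) ?_
    · rw [mul_div_assoc', div_le_iff₀ hn']; linarith [hM i]
    · rw [le_div_iff₀ hn']; linarith
  have hp : ∀ i, 0 < p i := fun i => lt_of_lt_of_le (half_pos (hq i)) (hhalf i)
  -- The empirical p.m.f. maximises the likelihood, so it suffices to compare it with `p`.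
  have h1 : ∏ j, q (x j) ≤ ∏ j, empirical x (x j) := by
    refine (prod_le_exp_mul_prod_empirical hn x (fun i => (hq i).le) hq1).trans ?_
    refine mul_le_of_le_one_left (Finset.prod_nonneg fun j _ => empirical_nonneg x _) ?_
    rw [Real.exp_le_one_iff, neg_nonpos]
    exact mul_nonneg hn'.le (hellSq_nonneg _ _)
  have h2 := h1.trans (prod_empirical_le_exp_mul_prod hn x hp hp1)
  rw [Real.exp_neg, inv_mul_le_iff₀ (Real.exp_pos _)]
  refine h2.trans (mul_le_mul_of_nonneg_right (Real.exp_le_exp.2 ?_)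
    (Finset.prod_nonneg fun j _ => (hp _).le))
  have h3 := mul_le_mul_of_nonneg_left (chiSq_le_of_half_le (p := empirical x) hq hhalf) hn'.le
  linarith

end Likelihood

end PosteriorConcentration

namespace PosteriorConcentration

/-! ### Pearson's statistic under i.i.d. sampling -/

section Empirical

variable {k : ℕ} (n : ℕ) (θ : stdSimplex ℝ (Fin (k + 1)))

theorem integral_indicator_pmfMeasure (i : Fin (k + 1)) :
    ∫ a, (if a = i then (1 : ℝ) else 0) ∂pmfMeasure θ = θ i := by
  rw [integral_fintype Integrable.of_finite]
  simp [Measure.real, pmfMeasure_singleton]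

theorem integral_count_sampleLaw (i : Fin (k + 1)) :
    ∫ x, ∑ j, (if x j = i then (1 : ℝ) else 0) ∂sampleLaw n θ = n * θ i := by
  rw [integral_finsetSum _ fun _ _ => Integrable.of_finite]
  have h : ∀ j, ∫ x, (if x j = i then (1 : ℝ) else 0) ∂sampleLaw n θ = θ i := by
    intro j
    rw [← integral_indicator_pmfMeasure θ i,
      ← (measurePreserving_eval (fun _ : Fin n => pmfMeasure θ) j).map_eq,
      integral_map (measurable_pi_apply j).aemeasurable
        (measurable_of_countable _).aestronglyMeasurable]
    rfl
  simp [h]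

/-- The cell count is a sum of independent indicators, and the variance of an indicator is at most
its mean. -/
theorem integral_sq_count_sub_le (i : Fin (k + 1)) :
    ∫ x, (∑ j, (if x j = i then (1 : ℝ) else 0) - n * θ i) ^ 2 ∂sampleLaw n θ ≤ n * θ i := by
  have hv := variance_sum_pi (μ := fun _ : Fin n => pmfMeasure θ)
    (X := fun _ a => if a = i then (1 : ℝ) else 0) fun _ => MemLp.of_discrete
  rw [variance_eq_integral (measurable_of_countable _).aemeasurable] at hv
  simp only [Finset.sum_apply] at hv
  have h1 := integral_count_sampleLaw n θ i
  rw [sampleLaw] at h1 ⊢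
  rw [h1] at hv
  rw [hv, Finset.sum_const, Finset.card_univ, Fintype.card_fin, nsmul_eq_mul]
  refine mul_le_mul_of_nonneg_left ?_ (Nat.cast_nonneg _)
  refine (variance_le_expectation_sq (measurable_of_countable _).aestronglyMeasurable).trans ?_
  refine le_of_eq ?_
  rw [← integral_indicator_pmfMeasure θ i]
  congr 1
  ext a
  simp

/-- Pearson's statistic exceeds `t` with probability at most `(k + 1) / t`. -/
theorem sampleLaw_lt_chiSq_empirical_le (hn : n ≠ 0) (hθ : ∀ i, 0 < θ i) {t : ℝ} (ht : 0 < t) :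
    sampleLaw n θ {x | t < n * chiSq (empirical x) θ} ≤ ENNReal.ofReal ((k + 1) / t) := by
  have hn' : (0 : ℝ) < n := by positivity
  set f : (Fin n → Fin (k + 1)) → ℝ := fun x => n * chiSq (empirical x) θ
  have hf : ∀ x, f x = ∑ i, (∑ j, (if x j = i then (1 : ℝ) else 0) - n * θ i) ^ 2 / (n * θ i) := by
    intro x
    simp only [f, chiSq, Finset.mul_sum, empirical]
    refine Finset.sum_congr rfl fun i _ => ?_
    have := (hθ i).ne'
    field_simp
  have hint : ∫ x, f x ∂sampleLaw n θ ≤ k + 1 := by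
    simp_rw [hf]
    rw [integral_finsetSum _ fun _ _ => Integrable.of_finite]
    calc _ ≤ ∑ i : Fin (k + 1), (1 : ℝ) := by
          refine Finset.sum_le_sum fun i _ => ?_
          rw [integral_div, div_le_one (mul_pos hn' (hθ i))]
          exact integral_sq_count_sub_le n θ i
      _ = k + 1 := by simp
  have hf0 : ∀ x, 0 ≤ f x := fun x =>
    mul_nonneg hn'.le (Finset.sum_nonneg fun i _ => div_nonneg (sq_nonneg _) (hθ i).le)
  have hm := mul_meas_ge_le_integral_of_nonneg (μ := sampleLaw n θ) (ae_of_all _ hf0)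
    Integrable.of_finite t
  have h2 : (sampleLaw n θ).real {x | t ≤ f x} ≤ (k + 1) / t := by
    rw [le_div_iff₀ ht, mul_comm]
    exact hm.trans hint
  refine (measure_mono (t := {x | t ≤ f x}) fun x hx =>
    le_of_lt (show t < f x from hx)).trans ?_
  exact (ENNReal.le_ofReal_iff_toReal_le (measure_ne_top _ _) (by positivity)).2 h2

end Empirical

/-! ### Bayes' formula on a finite sample space -/

section Posterior

variable {n k : ℕ} (W : Measure (stdSimplex ℝ (Fin (k + 1))))

theorem comp_singleton (x : Fin n → Fin (k + 1)) :
    (model n k ∘ₘ W) {x} = ∫⁻ τ, sampleLaw n τ {x} ∂W :=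
  Measure.bind_apply (measurableSet_singleton x) (model n k).aemeasurable

/-- The posterior kernel is determined only almost surely for the marginal law of the sample.
Positive marginal mass at `x` makes its value there unambiguous. -/
theorem comp_singleton_ne_zero (x : Fin n → Fin (k + 1))
    {B : Set (stdSimplex ℝ (Fin (k + 1)))} (hWB : W B ≠ 0)
    (hpos : ∀ τ ∈ B, ∀ i, 0 < τ i) : (model n k ∘ₘ W) {x} ≠ 0 := by
  rw [comp_singleton]
  intro h
  have h2 : ∫⁻ τ in B, sampleLaw n τ {x} ∂W = 0 :=
    le_antisymm ((setLIntegral_le_lintegral B _).trans h.le) bot_le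
  refine (setLIntegral_pos_iff (μ := W) ((Measure.measurable_coe (measurableSet_singleton x)).comp
    (measurable_sampleLaw n k)) (s := B)).2 ?_ |>.ne' h2
  refine lt_of_lt_of_le (pos_iff_ne_zero.2 hWB) (measure_mono fun τ hτ => ⟨?_, hτ⟩)
  simp only [Function.mem_support, Function.comp_apply, sampleLaw_singleton, Finset.prod_ne_zero_iff]
  exact fun j _ => (ENNReal.ofReal_pos.2 (hpos τ hτ _)).ne'

variable [IsProbabilityMeasure W]

/-- Bayes' formula for the posterior probability of `A`. -/
theorem comp_singleton_mul_posterior (x : Fin n → Fin (k + 1))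
    {A : Set (stdSimplex ℝ (Fin (k + 1)))} (hA : MeasurableSet A) :
    (model n k ∘ₘ W) {x} * posterior (model n k) W x A =
      ∫⁻ τ in A, sampleLaw n τ {x} ∂W := by
  have h := congrArg (fun μ => μ ({x} ×ˢ A))
    (compProd_posterior_eq_map_swap (κ := model n k) (μ := W))
  beta_reduce at h
  rw [Measure.compProd_apply_prod (measurableSet_singleton x) hA,
    Measure.map_apply measurable_swap ((measurableSet_singleton x).prod hA),
    Set.preimage_swap_prod, Measure.compProd_apply_prod hA (measurableSet_singleton x),
    lintegral_singleton, mul_comm] at h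
  exact h

/-- If the likelihood at `x` is at most `a` on `A` and at least `b` on `B`, the posterior
probability of `A` is at most `a / (b W(B))`. -/
theorem posterior_mul_le (x : Fin n → Fin (k + 1)) {A B : Set (stdSimplex ℝ (Fin (k + 1)))}
    (hA : MeasurableSet A) (hB : MeasurableSet B) {a b : ℝ≥0∞}
    (ha : ∀ τ ∈ A, sampleLaw n τ {x} ≤ a) (hb : ∀ τ ∈ B, b ≤ sampleLaw n τ {x}) :
    b * W B * posterior (model n k) W x A ≤ a := by
  calc b * W B * posterior (model n k) W x A
      ≤ (model n k ∘ₘ W) {x} * posterior (model n k) W x A := by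
        refine mul_le_mul_left ?_ _
        rw [comp_singleton]
        refine le_trans ?_ (setLIntegral_le_lintegral B _)
        rw [← setLIntegral_const]
        exact setLIntegral_mono' hB hb
    _ = ∫⁻ τ in A, sampleLaw n τ {x} ∂W := comp_singleton_mul_posterior W x hA
    _ ≤ ∫⁻ τ in A, a ∂W := setLIntegral_mono' hA ha
    _ ≤ a := by
        rw [setLIntegral_const]
        exact mul_le_of_le_one_right' prob_le_one

theorem posterior_congr (x : Fin n → Fin (k + 1)) (hx : (model n k ∘ₘ W) {x} ≠ 0)
    {A A' : Set (stdSimplex ℝ (Fin (k + 1)))} (hA : MeasurableSet A) (hA' : MeasurableSet A')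
    (h : A =ᵐ[W] A') : posterior (model n k) W x A = posterior (model n k) W x A' := by
  rw [← ENNReal.mul_right_inj hx (measure_ne_top _ _), comp_singleton_mul_posterior W x hA,
    comp_singleton_mul_posterior W x hA', setLIntegral_congr h]

end Posterior

/-! ### The Fisher form and its level sets -/

section Geometry

variable {k : ℕ} (θ : stdSimplex ℝ (Fin (k + 1)))

theorem fisherForm_eq (h : Fin k → ℝ) :
    fisherForm θ h = ∑ i, h i ^ 2 / θ i.succ + (∑ i, h i) ^ 2 / θ 0 := by
  have e : ∀ i, (fisherInfo θ *ᵥ h) i = h i / θ i.succ + (∑ j, h j) / θ 0 := by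
    intro i
    rw [fisherInfo, Matrix.add_mulVec, Pi.add_apply, Matrix.mulVec_diagonal]
    simp only [Matrix.mulVec, dotProduct, Matrix.of_apply, ← Finset.mul_sum]
    ring
  simp only [fisherForm, dotProduct, e, mul_add, Finset.sum_add_distrib, ← Finset.sum_mul]
  congr 1
  · exact Finset.sum_congr rfl fun i _ => by ring
  · ring

/-- Since `h 0` is minus the sum of the other coordinates, the rank-one part of the Fisher matrix
supplies the term of cell `0`. -/
theorem fisherForm_tail {h : Fin (k + 1) → ℝ} (hh : ∑ i, h i = 0) :
    fisherForm θ (Fin.tail h) = sigmaSq θ h := by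
  rw [Fin.sum_univ_succ] at hh
  rw [fisherForm_eq, sigmaSq, Fin.sum_univ_succ, add_comm]
  simp only [Fin.tail]
  rw [show h 0 = -∑ i : Fin k, h i.succ by linarith, neg_sq]

theorem sum_deviation (n : ℕ) (τ : stdSimplex ℝ (Fin (k + 1))) : ∑ i, deviation n θ τ i = 0 := by
  simp only [deviation, ← Finset.mul_sum, Finset.sum_sub_distrib]
  rw [show ∑ i, τ i = 1 from τ.2.2, show ∑ i, θ i = 1 from θ.2.2]
  simp

theorem sigmaSq_deviation (n : ℕ) (τ : stdSimplex ℝ (Fin (k + 1))) :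
    sigmaSq θ (deviation n θ τ) = n * chiSq τ θ := by
  simp only [sigmaSq, deviation, chiSq, Finset.mul_sum, mul_pow, Real.sq_sqrt (Nat.cast_nonneg n),
    mul_div_assoc]

theorem fisherForm_tail_deviation (n : ℕ) (τ : stdSimplex ℝ (Fin (k + 1))) :
    fisherForm θ (Fin.tail (deviation n θ τ)) = n * chiSq τ θ := by
  rw [fisherForm_tail θ (sum_deviation θ n τ), sigmaSq_deviation]

theorem deviation_mem_ellipsoid_iff (hθ : ∀ i, 0 < θ i) (n : ℕ) (M : ℝ)
    (τ : stdSimplex ℝ (Fin (k + 1))) :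
    deviation n θ τ ∈ ellipsoid n θ M ↔ n * chiSq τ θ ≤ M := by
  rw [← sigmaSq_deviation]
  refine ⟨fun h => h.2.1, fun h => ⟨fun i hi => absurd hi (hθ i).ne', h, sum_deviation θ n τ,
    fun i => ?_⟩⟩
  have := mul_nonneg (Real.sqrt_nonneg (n : ℝ)) (show 0 ≤ τ i from τ.2.1 i)
  simp only [deviation]
  linarith

theorem measurable_chiSq :
    Measurable fun τ : stdSimplex ℝ (Fin (k + 1)) => chiSq τ θ := by
  refine Finset.measurable_sum _ fun i _ => ?_
  have : Measurable fun τ : stdSimplex ℝ (Fin (k + 1)) => τ i :=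
    (measurable_pi_apply i).comp measurable_subtype_coe
  exact ((this.sub_const _).pow_const 2).div_const _

/-- The level sets of the Fisher quadratic form around a point are Lebesgue null. -/
theorem volume_fisherForm_sub_eq (hθ : ∀ i, 0 < θ i) (c : Fin k → ℝ) {r : ℝ} (hr : 0 < r) :
    volume {u : Fin k → ℝ | fisherForm θ (u - c) = r} = 0 := by
  have hconv : Convex ℝ {u : Fin k → ℝ | fisherForm θ (u - c) ≤ r} := by
    have hs : ConvexOn ℝ Set.univ fun u : Fin k → ℝ => fisherForm θ (u - c) := by
      refine ⟨convex_univ, fun x _ y _ a b ha hb hab => ?_⟩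
      have key : ∀ s t d : ℝ, 0 < d → (a * s + b * t) ^ 2 / d ≤ a * (s ^ 2 / d) + b * (t ^ 2 / d) := by
        intro s t d hd
        rw [mul_div_assoc', mul_div_assoc', ← add_div]
        refine div_le_div_of_nonneg_right ?_ hd.le
        obtain rfl : b = 1 - a := by linarith
        nlinarith [mul_nonneg (mul_nonneg ha hb) (sq_nonneg (s - t))]
      have e : a • x + b • y - c = a • (x - c) + b • (y - c) := by
        rw [smul_sub, smul_sub, sub_add_sub_comm, ← add_smul, hab, one_smul]
      simp only [e]
      simp only [fisherForm_eq, smul_eq_mul, Pi.add_apply, Pi.smul_apply, mul_add, Finset.mul_sum,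
        Finset.sum_add_distrib]
      have h1 := Finset.sum_le_sum fun i (_ : i ∈ Finset.univ) =>
        key ((x - c) i) ((y - c) i) (θ i.succ) (hθ _)
      have h2 := key (∑ i, (x - c) i) (∑ i, (y - c) i) (θ 0) (hθ _)
      rw [Finset.sum_add_distrib] at h1
      rw [Finset.mul_sum, Finset.mul_sum] at h2
      linarith
    simpa using hs.convex_le r
  -- The frontier of a convex set is null, and the level set lies on it: moving `u` away from `c` by
  -- a factor `t > 1` multiplies the form by `t²` and leaves the sublevel set.
  refine measure_mono_null ?_ (hconv.addHaar_frontier volume)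
  intro u hu
  rw [Set.mem_ofPred_eq] at hu
  refine ⟨subset_closure hu.le, fun hint => ?_⟩
  have hcont : Tendsto (fun t : ℝ => c + t • (u - c)) (𝓝[>] 1) (𝓝 u) := by
    have : Continuous fun t : ℝ => c + t • (u - c) := by fun_prop
    have h := (this.tendsto 1).mono_left (nhdsWithin_le_nhds (s := Set.Ioi 1))
    simpa using h
  obtain ⟨t, ht, ht1⟩ := ((hcont.eventually (mem_interior_iff_mem_nhds.1 hint)).and
    self_mem_nhdsWithin).exists
  have hsc : fisherForm θ (t • (u - c)) = t ^ 2 * fisherForm θ (u - c) := by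
    simp only [fisherForm, Matrix.mulVec_smul, dotProduct_smul, smul_dotProduct, smul_eq_mul]
    ring
  have ht' : fisherForm θ (c + t • (u - c) - c) ≤ r := ht
  rw [add_sub_cancel_left, hsc, hu] at ht'
  have : (1 : ℝ) < t := ht1
  nlinarith [mul_pos (mul_pos hr (sub_pos.2 this)) (by linarith : 0 < t + 1)]

end Geometry

end PosteriorConcentration

namespace PosteriorConcentration

/-! ### Prior mass and posterior bounds at a fixed sample size -/

section FixedSampleSize

variable {n k : ℕ} {θ : stdSimplex ℝ (Fin (k + 1))}

theorem fisherForm_smul (c : ℝ) (h : Fin k → ℝ) :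
    fisherForm θ (c • h) = c ^ 2 * fisherForm θ h := by
  simp only [fisherForm, Matrix.mulVec_smul, dotProduct_smul, smul_dotProduct, smul_eq_mul]
  ring

theorem natCast_mul_fisherForm_tail_sub (τ : stdSimplex ℝ (Fin (k + 1))) :
    n * fisherForm θ (Fin.tail τ - Fin.tail θ) = n * chiSq τ θ := by
  rw [← fisherForm_tail_deviation, ← Real.sq_sqrt (Nat.cast_nonneg n), ← fisherForm_smul]
  rfl

theorem zero_mem_ellipsoid {M : ℝ} (hM : 0 ≤ M) : 0 ∈ ellipsoid n θ M := by
  refine ⟨fun _ _ => rfl, by simpa [sigmaSq] using hM, by simp, fun i => ?_⟩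
  have := mul_nonneg (Real.sqrt_nonneg (n : ℝ)) (show 0 ≤ θ i from θ.2.1 i)
  simpa using this

theorem densityAt_zero (w : (Fin k → ℝ) → ℝ≥0) : densityAt n θ w 0 = w (Fin.tail θ) := by
  simp [densityAt]

/-- Points of `ℝ^k` close to `θ` correspond to local parameters in the ellipsoid. -/
theorem exists_mem_ellipsoid_densityAt_eq (hn : n ≠ 0) (hθ : ∀ i, 0 < θ i) {M : ℝ}
    (hM : ∀ i, M ≤ n * θ i) {u : Fin k → ℝ} (hu : n * fisherForm θ (u - Fin.tail θ) ≤ M)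
    (w : (Fin k → ℝ) → ℝ≥0) : ∃ h ∈ ellipsoid n θ M, densityAt n θ w h = w u := by
  set v := u - Fin.tail θ with hv
  have hs : (0 : ℝ) < √n := Real.sqrt_pos.2 (by positivity)
  -- The point `u` need not come from a p.m.f.; coordinate `0` is chosen to make the sum zero, and
  -- the lower bounds on `h` follow from `h(i)² ≤ M θ(i) ≤ n θ(i)²`.
  set h : Fin (k + 1) → ℝ := Fin.cons (-∑ i, √n * v i) (fun i => √n * v i) with hh
  have hsum : ∑ i, h i = 0 := by simp [hh, Fin.sum_univ_succ]
  have hsig : sigmaSq θ h ≤ M := by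
    rw [← fisherForm_tail θ hsum]
    have : Fin.tail h = √(n : ℝ) • v := by
      ext i; simp [hh]
    rwa [this, fisherForm_smul, Real.sq_sqrt (Nat.cast_nonneg n)]
  refine ⟨h, ⟨fun i hi => absurd hi (hθ i).ne', hsig, hsum, fun i => ?_⟩, ?_⟩
  · have h1 : h i ^ 2 / θ i ≤ n * θ i :=
      ((Finset.single_le_sum (f := fun i => h i ^ 2 / θ i)
        (fun j _ => div_nonneg (sq_nonneg _) (hθ j).le) (Finset.mem_univ i)).trans hsig).trans (hM i)
    rw [div_le_iff₀ (hθ i)] at h1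
    have h2 : h i ^ 2 ≤ (√n * θ i) ^ 2 := by
      rw [mul_pow, Real.sq_sqrt (Nat.cast_nonneg n)]; linarith
    exact (abs_le_of_sq_le_sq' h2 (mul_nonneg hs.le (hθ i).le)).1
  · have : (Fin.tail fun i => θ i + h i / √(n : ℝ)) = u := by
      ext i
      simp [Fin.tail, hh, hv, mul_div_cancel_left₀ _ hs.ne']
    rw [densityAt, this]

/-- A small cube around `θ` is contained in the ball of radius `1` for the Fisher form scaled
by `n`. -/
theorem natCast_mul_fisherForm_sub_le_one (hn : 2 ≤ n) (hθ : ∀ i, 1 ≤ n * θ i)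
    {u : Fin k → ℝ} (hu : u ∈ Metric.closedBall (Fin.tail θ) (((n : ℝ) ^ 3)⁻¹)) :
    n * fisherForm θ (u - Fin.tail θ) ≤ 1 := by
  have hn2 : (2 : ℝ) ≤ n := by exact_mod_cast hn
  have hn0 : (0 : ℝ) < n := by linarith
  have hθ0 : ∀ i, 0 < θ i := fun i => pos_of_mul_pos_right (one_pos.trans_le (hθ i)) hn0.le
  have hkn : (k : ℝ) + 1 ≤ n := by
    have h1 : ∑ i : Fin (k + 1), (1 : ℝ) ≤ ∑ i, n * θ i := Finset.sum_le_sum fun i _ => hθ i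
    rw [← Finset.mul_sum, show ∑ i, θ i = 1 from θ.2.2] at h1
    simpa using h1
  have hk0 : (0 : ℝ) ≤ k := Nat.cast_nonneg k
  -- Cells of mass at least `1/n` and `k + 1 ≤ n` bound the scaled form by `n⁴ r²`, so this radius
  -- leaves room to spare.
  set r : ℝ := ((n : ℝ) ^ 3)⁻¹ with hr
  have hr0 : 0 < r := by positivity
  have hv : ∀ i, |(u - Fin.tail θ) i| ≤ r := fun i => by
    rw [Metric.mem_closedBall, dist_pi_le_iff hr0.le] at hu
    simpa [Real.dist_eq] using hu i
  set v := u - Fin.tail θ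
  have hdiv : ∀ (a : ℝ) i, a ^ 2 / θ i ≤ n * a ^ 2 := fun a i => by
    rw [div_le_iff₀ (hθ0 i)]
    nlinarith [mul_le_mul_of_nonneg_left (hθ i) (sq_nonneg a)]
  have h1 : ∑ i, v i ^ 2 / θ i.succ ≤ k * (n * r ^ 2) := by
    calc _ ≤ ∑ i : Fin k, n * r ^ 2 := Finset.sum_le_sum fun i _ => (hdiv _ _).trans
          (mul_le_mul_of_nonneg_left (sq_le_sq' (abs_le.1 (hv i)).1 (abs_le.1 (hv i)).2) hn0.le)
      _ = _ := by simp
  have h2 : |∑ i, v i| ≤ k * r := by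
    refine (Finset.abs_sum_le_sum_abs _ _).trans ?_
    calc _ ≤ ∑ i : Fin k, r := Finset.sum_le_sum fun i _ => hv i
      _ = _ := by simp
  have h3 : (∑ i, v i) ^ 2 / θ 0 ≤ n * (k * r) ^ 2 :=
    (hdiv _ _).trans (mul_le_mul_of_nonneg_left
      (sq_le_sq' (abs_le.1 h2).1 (abs_le.1 h2).2) hn0.le)
  rw [fisherForm_eq]
  have h4 : (k : ℝ) + k ^ 2 ≤ n ^ 2 := by nlinarith
  have h5 : (n : ℝ) ^ 4 * r ^ 2 ≤ 1 := by
    rw [hr, inv_pow, mul_inv_le_iff₀ (by positivity), one_mul, ← pow_mul]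
    exact pow_le_pow_right₀ (by linarith) (by norm_num)
  calc n * (∑ i, v i ^ 2 / θ i.succ + (∑ i, v i) ^ 2 / θ 0)
      ≤ n * (k * (n * r ^ 2) + n * (k * r) ^ 2) :=
        mul_le_mul_of_nonneg_left (add_le_add h1 h3) hn0.le
    _ = (k + k ^ 2) * (n ^ 2 * r ^ 2) := by ring
    _ ≤ n ^ 2 * (n ^ 2 * r ^ 2) := mul_le_mul_of_nonneg_right h4 (by positivity)
    _ = n ^ 4 * r ^ 2 := by ring
    _ ≤ 1 := h5

theorem measurable_tail_stdSimplex :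
    Measurable fun τ : stdSimplex ℝ (Fin (k + 1)) => (Fin.tail τ : Fin k → ℝ) :=
  measurable_pi_lambda _ fun i => (measurable_pi_apply i.succ).comp measurable_subtype_coe

variable {W : Measure (stdSimplex ℝ (Fin (k + 1)))} {w : (Fin k → ℝ) → ℝ≥0}

/-- Lower bound on the prior mass of a chi-square neighbourhood of `θ`. -/
theorem le_prior_chiSq_le (hW : IsPriorWithDensity W w) (hn : 2 ≤ n)
    (hθ : ∀ i, 1 ≤ n * θ i) {M t : ℝ} (hM : ∀ i, M ≤ n * θ i) (ht : 1 ≤ t) (hM1 : 1 ≤ M)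
    (hw : ∀ h ∈ ellipsoid n θ M, w (Fin.tail θ) ≤ 2 * densityAt n θ w h) :
    ENNReal.ofReal (w (Fin.tail θ) / 2 * (2 * ((n : ℝ) ^ 3)⁻¹) ^ k) ≤
      W {τ | n * chiSq τ θ ≤ t} := by
  have hn0 : n ≠ 0 := by omega
  have hθ0 : ∀ i, 0 < θ i := fun i =>
    pos_of_mul_pos_right (one_pos.trans_le (hθ i)) (Nat.cast_nonneg n)
  set C := Metric.closedBall (Fin.tail θ : Fin k → ℝ) (((n : ℝ) ^ 3)⁻¹) with hC
  have hCm : MeasurableSet C := Metric.isClosed_closedBall.measurableSet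
  have hmass := congrArg (fun μ => μ C) hW.2
  beta_reduce at hmass
  rw [Measure.map_apply measurable_tail_stdSimplex hCm, withDensity_apply _ hCm] at hmass
  have hsub : (fun τ : stdSimplex ℝ (Fin (k + 1)) => (Fin.tail τ : Fin k → ℝ)) ⁻¹' C ⊆
      {τ | n * chiSq τ θ ≤ t} := fun τ hτ => by
    have := natCast_mul_fisherForm_sub_le_one hn hθ (show Fin.tail τ ∈ C from hτ)
    rw [natCast_mul_fisherForm_tail_sub] at this
    exact this.trans ht
  refine le_trans ?_ (measure_mono hsub)
  rw [hmass]
  have hvol : volume C = ENNReal.ofReal ((2 * ((n : ℝ) ^ 3)⁻¹) ^ k) := by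
    rw [hC, Real.volume_pi_closedBall _ (by positivity), Fintype.card_fin]
  rw [ENNReal.ofReal_mul (by positivity), ← hvol, ← setLIntegral_const]
  refine setLIntegral_mono' hCm fun u hu => ?_
  obtain ⟨h, hh, hhu⟩ := exists_mem_ellipsoid_densityAt_eq hn0 hθ0 hM
    ((natCast_mul_fisherForm_sub_le_one hn hθ hu).trans hM1) w
  have h1 := hw h hh
  rw [hhu] at h1
  have h2 : (w (Fin.tail θ) : ℝ) ≤ 2 * w u := by exact_mod_cast h1
  refine (ENNReal.ofReal_le_ofReal (show (w (Fin.tail θ) : ℝ) / 2 ≤ w u by linarith)).trans ?_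
  rw [ENNReal.ofReal_coe_nnreal]

/-- The cube costs `3k log n = 6 · (k/2) log n` in the exponent and the density at `θ` costs `-log
a`; each unit is at most `M / 1000`, whence `7 / 1000`. -/
theorem le_half_mul_pow {a M : ℝ} (hn : 2 ≤ n) (ha : 0 < a)
    (hk : (k : ℝ) / 2 * Real.log n ≤ M / 1000) (hlog : -Real.log a ≤ M / 1000) :
    Real.exp (-(7 / 1000 * M)) / 2 ≤ a / 2 * (2 * ((n : ℝ) ^ 3)⁻¹) ^ k := by
  have hn0 : (0 : ℝ) < n := by positivity
  have h1 : Real.exp (-(M / 1000)) ≤ a := by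
    rw [← Real.le_log_iff_exp_le ha]; linarith
  have h2 : Real.exp (-(6 * (M / 1000))) ≤ (((n : ℝ) ^ 3)⁻¹) ^ k := by
    rw [← Real.le_log_iff_exp_le (by positivity), Real.log_pow, Real.log_inv, Real.log_pow]
    push_cast
    linarith
  have h3 : (((n : ℝ) ^ 3)⁻¹) ^ k ≤ (2 * ((n : ℝ) ^ 3)⁻¹) ^ k :=
    pow_le_pow_left₀ (by positivity) (by linarith [show 0 < ((n : ℝ) ^ 3)⁻¹ by positivity]) _
  rw [show -(7 / 1000 * M) = -(M / 1000) + -(6 * (M / 1000)) by ring, Real.exp_add,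
    mul_div_right_comm]
  exact mul_le_mul (by linarith) (h2.trans h3) (Real.exp_pos _).le (by positivity)

theorem sampleLaw_singleton_eq_ofReal (τ : stdSimplex ℝ (Fin (k + 1))) (x : Fin n → Fin (k + 1)) :
    sampleLaw n τ {x} = ENNReal.ofReal (∏ j, τ (x j)) := by
  rw [sampleLaw_singleton]
  exact (ENNReal.ofReal_prod_of_nonneg fun j _ => τ.2.1 (x j)).symm

/-- Posterior mass far from `θ`, for samples whose empirical p.m.f. is close to `θ`. -/
theorem posterior_chiSq_ge_le [IsProbabilityMeasure W] (hn : 2 ≤ n) {M : ℝ}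
    (hθ : ∀ i, M ≤ n * θ i) (hM1 : 1000 ≤ M)
    (hc : ENNReal.ofReal (Real.exp (-(7 / 1000 * M)) / 2) ≤ W {τ | n * chiSq τ θ ≤ M / 1000})
    (x : Fin n → Fin (k + 1)) (hx : n * chiSq (empirical x) θ ≤ M / 1000) :
    posterior (model n k) W x {τ | M ≤ n * chiSq τ θ} ≤
      ENNReal.ofReal (2 * Real.exp (-(M / 50))) := by
  have hn0 : n ≠ 0 := by omega
  have hθ0 : ∀ i, 0 < θ i := fun i =>
    pos_of_mul_pos_right (by linarith [hθ i]) (Nat.cast_nonneg n)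
  set P := ∏ j, θ (x j)
  have hP : 0 < P := Finset.prod_pos fun j _ => hθ0 _
  have hmeas := (measurable_chiSq θ).const_mul (n : ℝ)
  have hx' : n * chiSq (empirical x) θ ≤ 1 / 1000 * M := by linarith
  have hb := posterior_mul_le W x (A := {τ | M ≤ n * chiSq τ θ})
    (B := {τ | n * chiSq τ θ ≤ M / 1000})
    (a := ENNReal.ofReal (Real.exp (-((1 / 18 - 2 * (1 / 1000)) * M)) * P))
    (b := ENNReal.ofReal (Real.exp (-(8 * (1 / 1000) * M)) * P))
    (measurableSet_le measurable_const hmeas) (measurableSet_le hmeas measurable_const)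
    (fun τ hτ => by
      rw [sampleLaw_singleton_eq_ofReal]
      exact ENNReal.ofReal_le_ofReal (prod_le_exp_neg_mul_prod hn0 x τ.2.1 τ.2.2 hθ0 θ.2.2
        (fun i => by linarith [hθ i]) hx' hτ))
    (fun τ hτ => by
      rw [sampleLaw_singleton_eq_ofReal]
      refine ENNReal.ofReal_le_ofReal (exp_neg_mul_prod_le_prod hn0 x τ.2.2 hθ0 θ.2.2
        (fun i => by linarith [hθ i]) hx' ?_)
      have : n * chiSq τ θ ≤ M / 1000 := hτ
      linarith)
  set p := posterior (model n k) W x {τ | M ≤ n * chiSq τ θ}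
  set d := Real.exp (-(8 * (1 / 1000) * M)) * P * (Real.exp (-(7 / 1000 * M)) / 2) with hd
  have hd0 : 0 < d := by positivity
  have h1 : ENNReal.ofReal d * p ≤
      ENNReal.ofReal (Real.exp (-((1 / 18 - 2 * (1 / 1000)) * M)) * P) := by
    refine le_trans ?_ hb
    rw [hd, ENNReal.ofReal_mul (by positivity)]
    gcongr
  -- The rate `1/50` is admissible because `1/18 - 2/1000 - 8/1000 - 7/1000 > 1/50`.
  have h2 : Real.exp (-((1 / 18 - 2 * (1 / 1000)) * M)) * P ≤ d * (2 * Real.exp (-(M / 50))) := by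
    have : d * (2 * Real.exp (-(M / 50))) = Real.exp (-(8 * (1 / 1000) * M) +
        -(7 / 1000 * M) + -(M / 50)) * P := by
      rw [Real.exp_add, Real.exp_add]; ring
    rw [this]
    refine mul_le_mul_of_nonneg_right (Real.exp_le_exp.2 ?_) hP.le
    linarith
  have h3 := h1.trans (ENNReal.ofReal_le_ofReal h2)
  rw [ENNReal.ofReal_mul hd0.le] at h3
  exact (ENNReal.mul_le_mul_iff_right (ENNReal.ofReal_pos.2 hd0).ne' ENNReal.ofReal_ne_top).1 h3

theorem lintegral_posterior_chiSq_ge_le [IsProbabilityMeasure W] (hn : 2 ≤ n) {M : ℝ}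
    (hθ : ∀ i, M ≤ n * θ i) (hM1 : 1000 ≤ M)
    (hc : ENNReal.ofReal (Real.exp (-(7 / 1000 * M)) / 2) ≤ W {τ | n * chiSq τ θ ≤ M / 1000}) :
    ∫⁻ x, posterior (model n k) W x {τ | M ≤ n * chiSq τ θ} ∂sampleLaw n θ ≤
      ENNReal.ofReal ((k + 1) / (M / 1000)) + ENNReal.ofReal (2 * Real.exp (-(M / 50))) := by
  have hθ0 : ∀ i, 0 < θ i := fun i =>
    pos_of_mul_pos_right (by linarith [hθ i]) (Nat.cast_nonneg n)
  set G : Set (Fin n → Fin (k + 1)) := {x | M / 1000 < n * chiSq (empirical x) θ}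
  have hG : MeasurableSet G := Set.Finite.measurableSet (Set.toFinite G)
  have hpt : ∀ x, posterior (model n k) W x {τ | M ≤ n * chiSq τ θ} ≤
      G.indicator 1 x + ENNReal.ofReal (2 * Real.exp (-(M / 50))) := by
    intro x
    by_cases hx : x ∈ G
    · rw [Set.indicator_of_mem hx]
      exact prob_le_one.trans le_self_add
    · exact (posterior_chiSq_ge_le hn hθ hM1 hc x (not_lt.1 hx)).trans le_add_self
  refine (lintegral_mono hpt).trans ?_
  rw [lintegral_add_right _ measurable_const, lintegral_indicator_one hG, lintegral_const,
    measure_univ, mul_one]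
  gcongr
  exact sampleLaw_lt_chiSq_empirical_le n θ (by omega) hθ0 (by linarith)

/-- The prior does not charge the boundary of the chi-square balls. -/
theorem prior_chiSq_eq (hW : IsPriorWithDensity W w) (hn : n ≠ 0) (hθ : ∀ i, 0 < θ i) {M : ℝ}
    (hM : 0 < M) : W {τ | n * chiSq τ θ = M} = 0 := by
  have hn0 : (0 : ℝ) < n := by positivity
  have hac : W.map (fun τ : stdSimplex ℝ (Fin (k + 1)) => (Fin.tail τ : Fin k → ℝ)) ≪ volume := by
    rw [hW.2]; exact withDensity_absolutelyContinuous _ _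
  have h0 := hac (volume_fisherForm_sub_eq θ hθ (Fin.tail θ) (div_pos hM hn0))
  refine measure_mono_null (fun τ hτ => ?_) (Measure.preimage_null_of_map_null
    measurable_tail_stdSimplex.aemeasurable h0)
  have h1 : n * chiSq τ θ = M := hτ
  rw [← natCast_mul_fisherForm_tail_sub] at h1
  change fisherForm θ (Fin.tail τ - Fin.tail θ) = M / n
  rw [eq_div_iff hn0.ne', mul_comm]
  exact h1

/-- The two events differ by a prior-null set. Near `θ` every cell probability is positive, so prior
mass there gives every sample `x` positive marginal probability and the equality holds pointwise. -/
theorem posterior_chiSq_ge_eq_gt [IsProbabilityMeasure W] (hW : IsPriorWithDensity W w)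
    (hn : n ≠ 0) (hθ : ∀ i, 0 < θ i) {M t : ℝ} (hM : 0 < M) (ht : ∀ i, 4 * t ≤ n * θ i)
    (hB : W {τ | n * chiSq τ θ ≤ t} ≠ 0) (x : Fin n → Fin (k + 1)) :
    posterior (model n k) W x {τ | M ≤ n * chiSq τ θ} =
      posterior (model n k) W x {τ | M < n * chiSq τ θ} := by
  have hn0 : (0 : ℝ) < n := by positivity
  have hmeas := (measurable_chiSq θ).const_mul (n : ℝ)
  refine posterior_congr W x (comp_singleton_ne_zero W x hB fun τ hτ i => ?_)
    (measurableSet_le measurable_const hmeas) (measurableSet_lt measurable_const hmeas) ?_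
  · refine (half_pos (hθ i)).trans_le (half_le_of_chiSq_le (r := t / n) hθ (fun i => ?_) ?_ i)
    · rw [mul_div_assoc', div_le_iff₀ hn0]; linarith [ht i]
    · rw [le_div_iff₀ hn0, mul_comm]; exact hτ
  · have h : ∀ᵐ τ : stdSimplex ℝ (Fin (k + 1)) ∂W, ¬ n * chiSq τ θ = M := by
      simpa [ae_iff] using prior_chiSq_eq hW hn hθ hM
    filter_upwards [h] with τ hτ
    exact propext ⟨fun h1 => lt_of_le_of_ne h1 (Ne.symm hτ), fun h1 => le_of_lt h1⟩

end FixedSampleSize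

/-! ### Consequences of the asymptotic conditions -/

section Asymptotics

variable {θ₀ : PMF ℕ+} {k : ℕ → ℕ} {w : ∀ n, (Fin (k n) → ℝ) → ℝ≥0} {M : ℕ → ℝ}

theorem minProb_le {k : ℕ} (θ : stdSimplex ℝ (Fin (k + 1))) (i : Fin (k + 1)) : minProb θ ≤ θ i :=
  ciInf_le (Set.finite_range _).bddBelow i

theorem TruncationCondition.eventually_one_le (h : TruncationCondition θ₀ k) :
    ∀ᶠ n : ℕ in atTop, ∀ i, 1 ≤ n * truncPmf θ₀ (k n) i := by
  filter_upwards [h.eventually_ge_atTop 1] with n hn i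
  exact hn.trans (mul_le_mul_of_nonneg_left (minProb_le _ i) (Nat.cast_nonneg n))

theorem eventually_le_mul_truncPmf (h : TruncationCondition θ₀ k)
    (hM : M =o[atTop] fun n : ℕ => (n : ℝ) * minProb (truncPmf θ₀ (k n))) :
    ∀ᶠ n : ℕ in atTop, ∀ i, M n ≤ n * truncPmf θ₀ (k n) i := by
  filter_upwards [hM.bound one_pos, Tendsto.eventually_ge_atTop h 0] with n hn hn0 i
  rw [Real.norm_eq_abs, Real.norm_eq_abs, one_mul, abs_of_nonneg hn0] at hn
  exact ((le_abs_self _).trans hn).trans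
    (mul_le_mul_of_nonneg_left (minProb_le _ i) (Nat.cast_nonneg n))

theorem PriorSmoothness.eventually_le_two_mul (h : PriorSmoothness θ₀ k w M)
    (hM : Tendsto M atTop atTop) :
    ∀ᶠ n in atTop, ∀ g ∈ ellipsoid n (truncPmf θ₀ (k n)) (M n),
      w n (Fin.tail (truncPmf θ₀ (k n))) ≤ 2 * densityAt n (truncPmf θ₀ (k n)) (w n) g := by
  filter_upwards [h.eventually_le_const ENNReal.one_lt_two, hM.eventually_ge_atTop 0]
    with n hn hM0 g hg
  -- The supremum is eventually at most `2`; the numerator is taken at local parameter `0`, that is,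
  -- at `θ₀` itself.
  have h1 := (le_iSup₂_of_le (f := fun h (_ : h ∈ ellipsoid n (truncPmf θ₀ (k n)) (M n)) =>
    ⨆ g ∈ ellipsoid n (truncPmf θ₀ (k n)) (M n),
      (densityAt n (truncPmf θ₀ (k n)) (w n) h : ℝ≥0∞) /
        (densityAt n (truncPmf θ₀ (k n)) (w n) g : ℝ≥0∞)) 0 (zero_mem_ellipsoid hM0)
    (le_iSup₂_of_le g hg le_rfl)).trans hn
  rw [ENNReal.div_le_iff_le_mul (Or.inr ENNReal.ofNat_ne_top) (Or.inl ENNReal.coe_ne_top),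
    densityAt_zero] at h1
  rw [← ENNReal.coe_ofNat, ← ENNReal.coe_mul, ENNReal.coe_le_coe] at h1
  exact h1

theorem PriorConcentration.eventually_le (h : PriorConcentration θ₀ k w M)
    (hM : Tendsto M atTop atTop) {ε : ℝ} (hε : 0 < ε) :
    ∀ᶠ n in atTop, (k n : ℝ) / 2 * Real.log n ≤ ε * M n ∧
      -Real.log (w n (Fin.tail (truncPmf θ₀ (k n)))) ≤ ε * M n := by
  filter_upwards [h.2.bound hε, hM.eventually_ge_atTop 0] with n hn hM0
  rw [Real.norm_eq_abs, Real.norm_eq_abs, abs_of_nonneg hM0] at hn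
  have h1 := (le_abs_self _).trans hn
  exact ⟨((le_max_left _ _).trans (le_max_left _ _)).trans h1, (le_max_right _ _).trans h1⟩

/-- Once `log n ≥ 2`, `k ≤ (k/2) log n = o(M)`, and `k + 1 ≤ 2k`. -/
theorem PriorConcentration.tendsto_div (h : PriorConcentration θ₀ k w M)
    (hk : ∀ n, 1 ≤ k n) (hM : Tendsto M atTop atTop) :
    Tendsto (fun n => ((k n : ℝ) + 1) / (M n / 1000)) atTop (𝓝 0) := by
  have hlog : ∀ᶠ n : ℕ in atTop, 2 ≤ Real.log n :=
    (Real.tendsto_log_atTop.comp tendsto_natCast_atTop_atTop).eventually_ge_atTop 2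
  refine tendsto_order.2 ⟨fun a ha => ?_, fun a ha => ?_⟩
  · filter_upwards [hM.eventually_gt_atTop 0] with n hn
    exact ha.trans_le (by positivity)
  · filter_upwards [h.eventually_le hM (ε := a / 4000) (by positivity), hlog,
      hM.eventually_gt_atTop 0] with n hn hl hM0
    have h1 : (1 : ℝ) ≤ k n := by exact_mod_cast hk n
    rw [div_lt_iff₀ (by positivity)]
    have := mul_pos ha hM0
    nlinarith [hn.1]

end Asymptotics

end PosteriorConcentration

/-! ### The concentration theorem -/

theorem lemma3p6 (θ₀ : PMF ℕ+) (k : ℕ → ℕ) (hk : ∀ n, 1 ≤ k n) (hk_mono : Monotone k)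
    (W : ∀ n, Measure (stdSimplex ℝ (Fin (k n + 1)))) [∀ n, IsProbabilityMeasure (W n)]
    (w : ∀ n, (Fin (k n) → ℝ) → ℝ≥0) (hW : ∀ n, IsPriorWithDensity (W n) (w n))
    (M : ℕ → ℝ) (hM_mono : Monotone M) (hM : Tendsto M atTop atTop)
    (h_trunc : TruncationCondition θ₀ k)
    (h_smooth : PriorSmoothness θ₀ k w M)
    (h_conc : PriorConcentration θ₀ k w M)
    (hM_small : M =o[atTop] fun n : ℕ => (n : ℝ) * minProb (truncPmf θ₀ (k n))) :
    (∀ᶠ n in atTop,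
      expectedPosterior θ₀ n (k n) (W n)
          {τ | M n ≤ fisherForm (truncPmf θ₀ (k n))
            (Fin.tail (deviation n (truncPmf θ₀ (k n)) τ))} =
        expectedPosterior θ₀ n (k n) (W n)
          {τ | deviation n (truncPmf θ₀ (k n)) τ ∉ ellipsoid n (truncPmf θ₀ (k n)) (M n)}) ∧
    Tendsto (fun n : ℕ => expectedPosterior θ₀ n (k n) (W n)
        {τ | M n ≤ fisherForm (truncPmf θ₀ (k n))
          (Fin.tail (deviation n (truncPmf θ₀ (k n)) τ))})
      atTop (𝓝 0) := by
  -- Requiring `M n ≥ 1000` makes the radius `M n / 1000` at least `1`, so the ball contains the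
  -- small cube. This mass bound serves both claims: positivity of the marginal and the posterior
  -- denominator.
  have hmass : ∀ᶠ n in atTop, ENNReal.ofReal (Real.exp (-(7 / 1000 * M n)) / 2) ≤
      W n {τ | n * chiSq τ (truncPmf θ₀ (k n)) ≤ M n / 1000} := by
    filter_upwards [h_conc.1, h_conc.eventually_le hM (ε := 1 / 1000) (by norm_num),
      h_smooth.eventually_le_two_mul hM, hM.eventually_ge_atTop 1000,
      h_trunc.eventually_one_le, eventually_le_mul_truncPmf h_trunc hM_small,
      eventually_ge_atTop 2] with n hw hlog hsm hM1 hθ hMθ hn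
    refine le_trans (ENNReal.ofReal_le_ofReal ?_) (le_prior_chiSq_le (hW n) hn hθ hMθ
      (by linarith) (by linarith) hsm)
    exact le_half_mul_pow hn (by exact_mod_cast hw) (by linarith [hlog.1]) (by linarith [hlog.2])
  simp only [fisherForm_tail_deviation, expectedPosterior]
  constructor
  · filter_upwards [hmass, hM.eventually_ge_atTop 1000, h_trunc.eventually_one_le,
      eventually_le_mul_truncPmf h_trunc hM_small, eventually_ge_atTop 2] with n hB hM1 hθ hMθ hn
    have hθ0 : ∀ i, 0 < truncPmf θ₀ (k n) i := fun i =>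
      pos_of_mul_pos_right (one_pos.trans_le (hθ i)) (Nat.cast_nonneg n)
    simp only [deviation_mem_ellipsoid_iff _ hθ0, not_le]
    refine lintegral_congr fun x => posterior_chiSq_ge_eq_gt (hW n) (by omega) hθ0 (by linarith)
      (t := M n / 1000) (fun i => by linarith [hMθ i]) ?_ x
    exact ((ENNReal.ofReal_pos.2 (by positivity)).trans_le hB).ne'
  · have hexp : Tendsto (fun n => 2 * Real.exp (-(M n / 50))) atTop (𝓝 0) := by
      have h1 := (Real.tendsto_exp_neg_atTop_nhds_zero.comp
        (hM.atTop_div_const (by norm_num : (0 : ℝ) < 50))).const_mul 2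
      simpa using h1
    have hlim := (ENNReal.tendsto_ofReal (h_conc.tendsto_div hk hM)).add
      (ENNReal.tendsto_ofReal hexp)
    rw [ENNReal.ofReal_zero, add_zero] at hlim
    refine tendsto_of_tendsto_of_tendsto_of_le_of_le' tendsto_const_nhds hlim
      (Eventually.of_forall fun _ => zero_le) ?_
    filter_upwards [hmass, hM.eventually_ge_atTop 1000,
      eventually_le_mul_truncPmf h_trunc hM_small, eventually_ge_atTop 2] with n hB hM1 hMθ hn
    exact lintegral_posterior_chiSq_ge_le hn hMθ hM1 hB
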